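/- Let $N\ge 2$, let $\mathbb Z_N=\{0,\dots,N-1\}$, and let $\mathcal K_N=\mathbb Z_N^{\mathbb N}$ be the space of infinite words $x_1x_2\dots$ with its product (Borel) $\sigma$-algebra and the shift $\sigma(x_1x_2x_3\dots)=x_2x_3\dots$. Let $\lambda=(\lambda_i)_{i\in\mathbb Z_N}$ be a vector with $\lambda_i>0$ and $\sum_i\lambda_i=1$, and let $T=(T^{(n)})_{n\ge1}$ be a sequence of $N\times N$ matrices with positive entries and all row sums equal to $1$, such that $\lambda T^{(1)}=\lambda$. The Markov measure associated to $(\lambda,T)$ is the Borel probability measure $\mu$ on $\mathcal K_N$ with $$\mu\{x: x_1=i_1,\dots,x_n=i_n\}=\lambda_{i_1}T^{(1)}_{i_1,i_2}T^{(2)}_{i_2,i_3}\cdots T^{(n-1)}_{i_{n-1},i_n}\qquad(n\ge 1,\ i_1,\dots,i_n\in\mathbb Z_N).$$ It is called quasi-stationary if $\sum_{n=1}^\infty\Bigl|\frac{T^{(n)}_{x_n,x_{n+1}}}{T^{(n+1)}_{x_n,x_{n+1}}}-1\Bigr|<\infty$ for all $x_1x_2\dots\in\mathcal K_N$. In that case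 put $F(x_1x_2\dots)=\prod_{n=1}^\infty \frac{T^{(n)}_{x_n,x_{n+1}}}{T^{(n+1)}_{x_n,x_{n+1}}}$ and, for $j\in\mathbb Z_N$, $$f_j(x_1x_2\dots)=\delta_{j,x_1}\sqrt{\frac{\lambda_{x_2}}{\lambda_{x_1}T^{(1)}_{x_1,x_2}}F(x_2x_3\dots)},\qquad S_jf=f_j\cdot(f\circ\sigma)\quad(f\in L^2(\mu)).$$ A representation of the Cuntz algebra $\mathcal O_N$ on a complex Hilbert space is a family of bounded operators $(S_j)_{j\in\mathbb Z_N}$ with $S_i^*S_j=\delta_{ij}I$ and $\sum_jS_jS_j^*=I$. Two representations $(S_j)$ on $H$ and $(S_j')$ on $H'$ are unitarily equivalent if there is a unitary $U:H\to H'$ with $US_j=S_j'U$ and $US_j^*=S_j'^*U$ for all $j$, and disjoint if $W=0$ is the only bounded operator $W:H\to H'$ with $WS_j=S_j'W$ and $WS_j^*=S_j'^*W$ for all $j$. **Theorem.** Let $\mu$ and $\mu'$ be two quasi-stationary Markov measures on $\mathcal K_N$, associated to $(\lambda,T)$ and $(\lambda',T')$. Then $\mu$ and $\mu'$ are either equivalent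 (mutually absolutely continuous) or mutually singular, and not both. The formulas above define representations of $\mathcal O_N$ on $L^2(\mu)$ and on $L^2(\mu')$, and these two representations are either unitarily equivalent or disjoint, and not both. -/

import Mathlib

open MeasureTheory
open scoped ENNReal Matrix

namespace QSMarkov

/-- The Cantor group `K_N` of infinite words over the alphabet `{0, …, N-1}`. Letters are indexed
from `0`, so the letter `x_{n+1}` of the usual 1-based notation is `x n`. The product
`σ`-algebra of the instance on functions is the Borel `σ`-algebra of the product topology. -/
abbrev Words (N : ℕ) : Type := ℕ → Fin N

/-- The one-sided shift `σ(x₁x₂x₃…) = x₂x₃…`. -/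
def shift {N : ℕ} (x : Words N) : Words N := fun n => x (n + 1)

/-- The cylinder set of a finite (nonempty) word `I`. -/
def wordCylinder {N n : ℕ} (I : Fin (n + 1) → Fin N) : Set (Words N) :=
  {x | ∀ k : Fin (n + 1), x k = I k}

/-- Initial vector and transition matrices of a Markov measure: `lam` is a positive probability
vector, every `T n` is a stochastic matrix with positive entries, and `lam` is a left fixed vector
of the first matrix. The matrix `T n` is `T^{(n+1)}` in 1-based notation. -/
structure IsMarkovData {N : ℕ} (lam : Fin N → ℝ) (T : ℕ → Matrix (Fin N) (Fin N) ℝ) : Prop where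
  lam_pos : ∀ i, 0 < lam i
  lam_sum : ∑ i, lam i = 1
  T_pos : ∀ n i j, 0 < T n i j
  T_sum : ∀ n i, ∑ j, T n i j = 1
  lam_T : lam ᵥ* T 0 = lam

/-- The quasi-stationarity condition on the sequence of transition matrices. -/
def IsQuasiStationary {N : ℕ} (T : ℕ → Matrix (Fin N) (Fin N) ℝ) : Prop :=
  ∀ x : Words N, Summable fun n : ℕ => |T n (x n) (x (n + 1)) / T (n + 1) (x n) (x (n + 1)) - 1|

/-- `μ` is a Markov measure associated to `lam` and `T`: its value on the cylinder of
`i₁ … i_{n+1}` is `lam_{i₁} T^{(1)}_{i₁ i₂} ⋯ T^{(n)}_{i_n i_{n+1}}`. (Since the cylinders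
generate, and `lam` sums to `1`, there is exactly one such measure, and it has total mass `1`.) -/
def IsMarkovMeasure {N : ℕ} (lam : Fin N → ℝ) (T : ℕ → Matrix (Fin N) (Fin N) ℝ)
    (μ : Measure (Words N)) : Prop :=
  ∀ (n : ℕ) (I : Fin (n + 1) → Fin N),
    μ (wordCylinder I) = ENNReal.ofReal (lam (I 0) * ∏ k : Fin n, T k (I k.castSucc) (I k.succ))

/-- The function `F(x) = ∏ₙ T^{(n)}_{xₙ xₙ₊₁} / T^{(n+1)}_{xₙ xₙ₊₁}`. Under quasi-stationarity
the product converges absolutely. -/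
noncomputable def F {N : ℕ} (T : ℕ → Matrix (Fin N) (Fin N) ℝ) (x : Words N) : ℝ :=
  ∏' n : ℕ, T n (x n) (x (n + 1)) / T (n + 1) (x n) (x (n + 1))

/-- The weight `f_j(x₁x₂…) = δ_{j,x₁} √(lam_{x₂} / (lam_{x₁} T^{(1)}_{x₁ x₂}) · F(x₂x₃…))`. -/
noncomputable def weight {N : ℕ} (lam : Fin N → ℝ) (T : ℕ → Matrix (Fin N) (Fin N) ℝ)
    (j : Fin N) (x : Words N) : ℝ :=
  if x 0 = j then √(lam (x 1) / (lam (x 0) * T 0 (x 0) (x 1)) * F T (shift x)) else 0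

/-- A representation of the Cuntz algebra `O_N` on a Hilbert space `H`, given by the images
`S_i` of the generators: bounded operators that satisfy the Cuntz relations. -/
structure CuntzRep (N : ℕ) (H : Type*) [NormedAddCommGroup H] [InnerProductSpace ℂ H]
    [CompleteSpace H] where
  S : Fin N → H →L[ℂ] H
  adjoint_comp : ∀ i j, (S i).adjoint ∘L S j = if i = j then ContinuousLinearMap.id ℂ H else 0
  sum_comp_adjoint : ∑ i, S i ∘L (S i).adjoint = ContinuousLinearMap.id ℂ H

/-- `π` is the representation on `L²(μ)` associated to `(lam, T)`: `S_j f = f_j · (f ∘ σ)`.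
This determines every `S_j`, hence `π`. -/
def IsAssociatedRep {N : ℕ} (lam : Fin N → ℝ) (T : ℕ → Matrix (Fin N) (Fin N) ℝ)
    (μ : Measure (Words N)) (π : CuntzRep N (Lp ℂ 2 μ)) : Prop :=
  ∀ (j : Fin N) (f : Lp ℂ 2 μ),
    (π.S j f : Words N → ℂ) =ᵐ[μ] fun x => (weight lam T j x : ℂ) * f (shift x)

section

variable {N : ℕ} {H H' : Type*} [NormedAddCommGroup H] [InnerProductSpace ℂ H] [CompleteSpace H]
  [NormedAddCommGroup H'] [InnerProductSpace ℂ H'] [CompleteSpace H']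

/-- A bounded operator intertwines two representations of `O_N` when it intertwines the images of
the generators and of their adjoints. -/
def Intertwines (π : CuntzRep N H) (π' : CuntzRep N H') (W : H →L[ℂ] H') : Prop :=
  ∀ i, W ∘L π.S i = π'.S i ∘L W ∧ W ∘L (π.S i).adjoint = (π'.S i).adjoint ∘L W

/-- Unitary equivalence: some unitary operator intertwines the two representations. -/
def UnitarilyEquivalent (π : CuntzRep N H) (π' : CuntzRep N H') : Prop :=
  ∃ U : H ≃ₗᵢ[ℂ] H', Intertwines π π' (U.toContinuousLinearEquiv : H →L[ℂ] H')

/-- Two representations are disjoint when the only bounded operator that intertwines them is `0`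
(equivalently, no nonzero subrepresentation of the one is unitarily equivalent to a
subrepresentation of the other). -/
def DisjointReps (π : CuntzRep N H) (π' : CuntzRep N H') : Prop :=
  ∀ W : H →L[ℂ] H', Intertwines π π' W → W = 0

end

end QSMarkov

/-! ### Cylinders, and comparison of finite measures on them. -/

namespace QSMarkov

variable {N : ℕ}

open PiNat (cylinder)

/-! The square of `weight lam T j` is the density, relative to `μ`, of the image of `μ` under `x ↦
jx` (`withDensity_weight`). On a long cylinder the ratio of the two masses is a partial product of
`F` times the factor `lam / (lam * T 0)`, and these partial products converge uniformly: by
finiteness of the alphabet, summability along each word gives a bound on the logarithms that is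
summable and independent of the word. It follows that the `S_j` are isometries whose ranges consist
of the functions supported on words with first letter `j`, which gives the Cuntz relations, and that
the shift and its inverse branches preserve null sets.

The same bound keeps all transition probabilities above some `ε > 0`, so past and future are
comparable to independent ones (`mul_measure_le_measure_inter`). A shift-invariant set `A` then
satisfies `ε μ(A) μ ≤ μ|_A`, which is the zero-one law. If `μ'` is not absolutely continuous with
respect to `μ`, some `μ`-null set is not `μ'`-null; enlarged to a shift-invariant `μ`-null set
(`exists_shift_invariant_null`), it has full `μ'`-measure, and the measures are singular.

For equivalent measures, multiplication by the square root of the density `dμ/dμ'` is a unitary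
intertwiner; `density_mul_weight` supplies the cocycle identity. For singular measures, an
intertwiner `W` commutes with the indicators of cylinders, because these are products of the `S_j`
and their adjoints. Hence `|W f|² μ' ≤ ‖W‖² |f|² μ`, so the left side is absolutely continuous with
respect to both measures and vanishes. -/

lemma measurable_shift : Measurable (shift : Words N → Words N) :=
  measurable_pi_lambda _ fun n => measurable_pi_apply (n + 1)

lemma measurableSet_cylinder (x : Words N) (n : ℕ) : MeasurableSet (cylinder x n) :=
  (PiNat.isOpen_cylinder _ x n).measurableSet

/-- Comparison of two measures on sets that depend on the first `n` letters only. -/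
lemma measure_le_of_cylinder {ν₁ ν₂ : Measure (Words N)} {n : ℕ}
    (h : ∀ x, ν₁ (cylinder x n) ≤ ν₂ (cylinder x n)) (S : Set (Fin n → Fin N)) :
    ν₁ ((fun (x : Words N) (i : Fin n) => x i) ⁻¹' S) ≤
      ν₂ ((fun (x : Words N) (i : Fin n) => x i) ⁻¹' S) := by
  classical
  set r : Words N → Fin n → Fin N := fun x i => x i with hr
  have hfib : ∀ b, r ⁻¹' {b} = ∅ ∨ ∃ x, r ⁻¹' {b} = cylinder x n := by
    intro b
    rcases (r ⁻¹' {b}).eq_empty_or_nonempty with h | ⟨x, hx⟩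
    · exact .inl h
    · refine .inr ⟨x, ?_⟩
      ext y
      rw [PiNat.mem_cylinder_iff, ← (show r x = b from hx)]
      constructor
      · intro hy i hi
        exact congrFun (show r y = r x from hy) ⟨i, hi⟩
      · intro hy
        exact funext fun i => hy i i.2
  have hmeas : ∀ b, MeasurableSet (r ⁻¹' {b}) := by
    intro b
    rcases hfib b with h | ⟨x, h⟩
    · rw [h]; exact MeasurableSet.empty
    · rw [h]; exact measurableSet_cylinder x n
  have hS : (S.toFinset : Set (Fin n → Fin N)) = S := by simp
  rw [← hS, ← sum_measure_preimage_singleton _ fun b _ => hmeas b,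
    ← sum_measure_preimage_singleton _ fun b _ => hmeas b]
  refine Finset.sum_le_sum fun b _ => ?_
  rcases hfib b with h' | ⟨x, h'⟩
  · simp [h']
  · rw [h']; exact h x

/-- Finite measures are ordered as soon as they are ordered on all long cylinders. -/
lemma measure_le_of_forall_cylinder {ν₁ ν₂ : Measure (Words N)} [IsFiniteMeasure ν₁]
    [IsFiniteMeasure ν₂] (n₀ : ℕ)
    (h : ∀ n ≥ n₀, ∀ x, ν₁ (cylinder x n) ≤ ν₂ (cylinder x n)) : ν₁ ≤ ν₂ := by
  -- A closed set is the decreasing intersection of the sets `D n` of words that agree with some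
  -- element of it in the first `n` letters. Inner regularity by closed sets then reaches all
  -- measurable sets.
  have key : ∀ K : Set (Words N), IsClosed K → ν₁ K ≤ ν₂ K := by
    intro K hK
    set r : ∀ n, Words N → Fin n → Fin N := fun n x i => x i with hr
    set D : ℕ → Set (Words N) := fun n => r n ⁻¹' (r n '' K) with hD
    have hmem : ∀ n x, x ∈ D n ↔ ∃ y ∈ K, y ∈ cylinder x n := by
      intro n x
      constructor
      · rintro ⟨y, hy, hyx⟩
        exact ⟨y, hy, fun i hi => congrFun hyx ⟨i, hi⟩⟩
      · rintro ⟨y, hy, hyx⟩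
        exact ⟨y, hy, funext fun i => hyx i i.2⟩
    have hanti : Antitone D := by
      intro m n hmn x hx
      obtain ⟨y, hy, hyx⟩ := (hmem n x).1 hx
      exact (hmem m x).2 ⟨y, hy, PiNat.cylinder_anti x hmn hyx⟩
    have hmeas : ∀ n, MeasurableSet (D n) := fun n =>
      (measurable_pi_lambda _ fun i => measurable_pi_apply _ : Measurable (r n))
        (Set.toFinite _).measurableSet
    have hint : ⋂ n, D n = K := by
      ext x
      constructor
      · intro hx
        by_contra hxK
        obtain ⟨n, hn⟩ := PiNat.exists_disjoint_cylinder hK hxK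
        obtain ⟨y, hy, hyx⟩ := (hmem n x).1 (Set.mem_iInter.1 hx n)
        exact Set.disjoint_left.1 hn hy hyx
      · intro hx
        exact Set.mem_iInter.2 fun n => (hmem n x).2 ⟨x, hx, PiNat.self_mem_cylinder x n⟩
    have t : ∀ ν : Measure (Words N), IsFiniteMeasure ν →
        Filter.Tendsto (fun n => ν (D n)) Filter.atTop (nhds (ν K)) := by
      intro ν _
      rw [← hint]
      exact tendsto_measure_iInter_atTop (fun n => (hmeas n).nullMeasurableSet) hanti
        ⟨0, measure_ne_top _ _⟩
    refine le_of_tendsto_of_tendsto (t ν₁ inferInstance) (t ν₂ inferInstance) ?_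
    filter_upwards [Filter.eventually_ge_atTop n₀] with n hn
    exact measure_le_of_cylinder (h n hn) _
  refine Measure.le_iff.2 fun A hA => ?_
  rw [hA.measure_eq_iSup_isClosed_of_ne_top (measure_ne_top ν₁ A)]
  exact iSup_le fun K => iSup_le fun hKA => iSup_le fun hK => (key K hK).trans (measure_mono hKA)

/-- Prefixing of a letter to a word. -/
def cons (j : Fin N) (x : Words N) : Words N
  | 0 => j
  | n + 1 => x n

@[simp] lemma cons_zero (j : Fin N) (x : Words N) : cons j x 0 = j := rfl

@[simp] lemma cons_succ (j : Fin N) (x : Words N) (n : ℕ) : cons j x (n + 1) = x n := rfl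

@[simp] lemma shift_apply (x : Words N) (n : ℕ) : shift x n = x (n + 1) := rfl

@[simp] lemma shift_cons (j : Fin N) (x : Words N) : shift (cons j x) = x := rfl

lemma cons_shift (x : Words N) : cons (x 0) (shift x) = x := by
  ext n; cases n <;> rfl

lemma measurable_cons (j : Fin N) : Measurable (cons j : Words N → Words N) := by
  refine measurable_pi_lambda _ fun n => ?_
  cases n with
  | zero => exact measurable_const
  | succ n => exact measurable_pi_apply n

/-- The set of words with first letter `j`. -/
def firstLetter (j : Fin N) : Set (Words N) := {x | x 0 = j}

lemma measurableSet_firstLetter (j : Fin N) : MeasurableSet (firstLetter j) :=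
  (measurable_pi_apply 0 : Measurable fun x : Words N => x 0) (measurableSet_singleton j)

@[simp] lemma mem_firstLetter {j : Fin N} {x : Words N} : x ∈ firstLetter j ↔ x 0 = j := Iff.rfl

lemma cylinder_succ (x : Words N) (n : ℕ) :
    cylinder x (n + 1) = firstLetter (x 0) ∩ shift ⁻¹' cylinder (shift x) n := by
  ext y
  simp only [PiNat.mem_cylinder_iff, Set.mem_inter_iff, mem_firstLetter, Set.mem_preimage,
    shift_apply]
  constructor
  · exact fun h => ⟨h 0 (by omega), fun i hi => h (i + 1) (by omega)⟩
  · rintro ⟨h0, h⟩ (_ | i) hi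
    · exact h0
    · exact h i (by omega)

lemma iterate_shift_apply (n : ℕ) (x : Words N) (k : ℕ) : shift^[n] x k = x (n + k) := by
  induction n generalizing x with
  | zero => simp
  | succ n ih => rw [Function.iterate_succ_apply, ih, shift_apply]; congr 1; omega

/-- The word whose first `n` letters are those of `x`, followed by `y`. -/
def concat (n : ℕ) (x y : Words N) : Words N := fun k => if k < n then x k else y (k - n)

lemma cylinder_concat (n m : ℕ) (x y : Words N) :
    cylinder (concat n x y) (n + m) = cylinder x n ∩ shift^[n] ⁻¹' cylinder y m := by
  ext z
  simp only [PiNat.mem_cylinder_iff, Set.mem_inter_iff, Set.mem_preimage, iterate_shift_apply,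
    concat]
  constructor
  · refine fun h => ⟨fun i hi => ?_, fun i hi => ?_⟩
    · simpa [hi] using h i (by omega)
    · simpa using h (n + i) (by omega)
  · rintro ⟨h1, h2⟩ i hi
    split_ifs with hin
    · exact h1 i hin
    · have := h2 (i - n) (by omega)
      rwa [show n + (i - n) = i by omega] at this

end QSMarkov

/-! ### Uniform consequences of quasi-stationarity, and the density of an inverse branch. -/

namespace QSMarkov

open PiNat (cylinder)
open Filter Topology

variable {N : ℕ} {lam : Fin N → ℝ} {T : ℕ → Matrix (Fin N) (Fin N) ℝ} {μ : Measure (Words N)}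

/-- The mass that a Markov measure gives to the cylinder of the first `n + 1` letters of `x`. -/
def cylinderMass (lam : Fin N → ℝ) (T : ℕ → Matrix (Fin N) (Fin N) ℝ) (n : ℕ) (x : Words N) : ℝ :=
  lam (x 0) * ∏ k ∈ Finset.range n, T k (x k) (x (k + 1))

lemma IsMarkovMeasure.cylinder (hμ : IsMarkovMeasure lam T μ) (n : ℕ) (x : Words N) :
    μ (cylinder x (n + 1)) = ENNReal.ofReal (cylinderMass lam T n x) := by
  have := hμ n fun k => x k
  rw [cylinderMass, Finset.prod_range]
  convert this using 2
  · ext y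
    exact ⟨fun h k => h k k.2, fun h i hi => h ⟨i, hi⟩⟩
  · simp

lemma IsMarkovData.cylinderMass_pos (h : IsMarkovData lam T) (n : ℕ) (x : Words N) :
    0 < cylinderMass lam T n x :=
  mul_pos (h.lam_pos _) (Finset.prod_pos fun _ _ => h.T_pos _ _ _)

lemma IsMarkovData.nonempty (h : IsMarkovData lam T) : Nonempty (Fin N) := by
  by_contra hN
  rw [not_nonempty_iff] at hN
  simpa using h.lam_sum

lemma IsMarkovMeasure.isProbabilityMeasure (hμ : IsMarkovMeasure lam T μ)
    (h : IsMarkovData lam T) : IsProbabilityMeasure μ := by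
  constructor
  have h1 : ∀ j : Fin N, μ (firstLetter j) = ENNReal.ofReal (lam j) := by
    intro j
    rw [show firstLetter j = PiNat.cylinder (fun _ : ℕ => j) 1 by ext; simp [PiNat.mem_cylinder_iff],
      hμ.cylinder 0]
    simp [cylinderMass]
  have h2 : ∑ j : Fin N, μ (firstLetter j) = μ Set.univ := by
    have := sum_measure_preimage_singleton (μ := μ) (Finset.univ : Finset (Fin N))
      (f := fun x : Words N => x 0) fun j _ => measurableSet_firstLetter j
    rw [Finset.coe_univ, Set.preimage_univ] at this
    exact this
  rw [← h2]
  simp_rw [h1]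
  rw [← ENNReal.ofReal_sum_of_nonneg fun i _ => (h.lam_pos i).le, h.lam_sum, ENNReal.ofReal_one]

lemma IsMarkovData.T_le_one (h : IsMarkovData lam T) (n : ℕ) (i j : Fin N) : T n i j ≤ 1 := by
  rw [← h.T_sum n i]
  exact Finset.single_le_sum (fun k _ => (h.T_pos n i k).le) (Finset.mem_univ j)

/-- The alternating words `ijij…` and `jiji…` together use the transition from `i` to `j` at every
time. -/
lemma IsQuasiStationary.summable_entry (hq : IsQuasiStationary T) (i j : Fin N) :
    Summable fun n => |T n i j / T (n + 1) i j - 1| := by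
  have he := hq fun n => if Even n then i else j
  have ho := hq fun n => if Even n then j else i
  refine Summable.of_nonneg_of_le (fun n => abs_nonneg _) (fun n => ?_) (he.add ho)
  by_cases hn : Even n
  · simp [hn, Nat.even_add_one]
  · simp [hn, Nat.even_add_one]

lemma IsQuasiStationary.exists_summable_bound (hq : IsQuasiStationary T) :
    ∃ A : ℕ → ℝ, Summable A ∧
      ∀ n i j, |Real.log (T n i j / T (n + 1) i j)| ≤ A n := by
  refine ⟨fun n => ∑ i, ∑ j, |Real.log (T n i j / T (n + 1) i j)|, ?_, ?_⟩
  · refine summable_sum fun i _ => summable_sum fun j _ => ?_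
    have := Real.summable_log_one_add_of_summable (hq.summable_entry i j).of_abs
    simpa using this.abs
  · intro n i j
    refine le_trans ?_ (Finset.single_le_sum
      (f := fun i => ∑ j, |Real.log (T n i j / T (n + 1) i j)|)
      (fun i _ => Finset.sum_nonneg fun j _ => abs_nonneg _) (Finset.mem_univ i))
    exact Finset.single_le_sum (f := fun j => |Real.log (T n i j / T (n + 1) i j)|)
      (fun j _ => abs_nonneg _) (Finset.mem_univ j)

/-- The logarithms of an entry telescope, so over all times it falls below its initial value by at
most the total of the summable bound; the initial matrix has a least entry. -/
lemma IsQuasiStationary.exists_lower_bound (hq : IsQuasiStationary T) (h : IsMarkovData lam T) :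
    ∃ ε > 0, ∀ n i j, ε ≤ T n i j := by
  obtain ⟨A, hA, hle⟩ := hq.exists_summable_bound
  have hA0 : ∀ n, 0 ≤ A n := fun n =>
    (abs_nonneg _).trans (hle n h.nonempty.some h.nonempty.some)
  have hlog : ∀ n i j, Real.log (T 0 i j) - ∑' k, A k ≤ Real.log (T n i j) := by
    intro n i j
    have : Real.log (T 0 i j) - ∑ k ∈ Finset.range n, A k ≤ Real.log (T n i j) := by
      induction n with
      | zero => simp
      | succ n ih =>
        have h1 := (abs_le.1 (hle n i j)).2
        rw [Real.log_div (h.T_pos _ _ _).ne' (h.T_pos _ _ _).ne'] at h1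
        rw [Finset.sum_range_succ]
        linarith
    have h2 := hA.sum_le_tsum (Finset.range n) fun k _ => hA0 k
    linarith
  have := h.nonempty
  obtain ⟨⟨i₀, j₀⟩, hmin⟩ := Finite.exists_min fun p : Fin N × Fin N => T 0 p.1 p.2
  refine ⟨T 0 i₀ j₀ * Real.exp (-∑' k, A k), mul_pos (h.T_pos _ _ _) (Real.exp_pos _), ?_⟩
  intro n i j
  calc T 0 i₀ j₀ * Real.exp (-∑' k, A k) ≤ T 0 i j * Real.exp (-∑' k, A k) := by
        gcongr; exact hmin (i, j)
    _ = Real.exp (Real.log (T 0 i j) - ∑' k, A k) := by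
        rw [sub_eq_add_neg, Real.exp_add, Real.exp_log (h.T_pos _ _ _)]
    _ ≤ T n i j := by
        rw [← Real.le_log_iff_exp_le (h.T_pos _ _ _)]
        exact hlog n i j

lemma IsQuasiStationary.summable_log (hq : IsQuasiStationary T) (x : Words N) :
    Summable fun n => Real.log (T n (x n) (x (n + 1)) / T (n + 1) (x n) (x (n + 1))) := by
  obtain ⟨A, hA, hle⟩ := hq.exists_summable_bound
  exact Summable.of_norm_bounded hA fun n => by simpa using hle n _ _

lemma IsQuasiStationary.F_eq (hq : IsQuasiStationary T) (h : IsMarkovData lam T) (x : Words N) :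
    F T x = Real.exp
      (∑' n, Real.log (T n (x n) (x (n + 1)) / T (n + 1) (x n) (x (n + 1)))) :=
  (Real.rexp_tsum_eq_tprod (fun _ => div_pos (h.T_pos _ _ _) (h.T_pos _ _ _))
    (hq.summable_log x)).symm

lemma IsQuasiStationary.F_pos (hq : IsQuasiStationary T) (h : IsMarkovData lam T) (x : Words N) :
    0 < F T x := by
  rw [hq.F_eq h]; exact Real.exp_pos _

lemma measurable_letters (g : Fin N → Fin N → ℝ) (m n : ℕ) :
    Measurable fun x : Words N => g (x m) (x n) :=
  (measurable_of_finite fun p : Fin N × Fin N => g p.1 p.2).comp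
    (.prodMk (measurable_pi_apply m) (measurable_pi_apply n) :
      Measurable fun x : Words N => (x m, x n))

lemma IsQuasiStationary.measurable_F (hq : IsQuasiStationary T) (h : IsMarkovData lam T) :
    Measurable (F T) := by
  have : F T = fun x => Real.exp
      (∑' n, Real.log (T n (x n) (x (n + 1)) / T (n + 1) (x n) (x (n + 1)))) :=
    funext fun x => hq.F_eq h x
  rw [this]
  refine Real.measurable_exp.comp ?_
  refine measurable_of_tendsto_metrizable (f := fun n x => ∑ k ∈ Finset.range n,
    Real.log (T k (x k) (x (k + 1)) / T (k + 1) (x k) (x (k + 1)))) (fun n => ?_) ?_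
  · exact Finset.measurable_sum _ fun k _ =>
      measurable_letters (fun i j => Real.log (T k i j / T (k + 1) i j)) k (k + 1)
  · rw [tendsto_pi_nhds]
    exact fun x => (hq.summable_log x).hasSum.tendsto_sum_nat

/-- The partial products of `F` converge to `F` uniformly, in the multiplicative sense. -/
lemma IsQuasiStationary.F_uniform (hq : IsQuasiStationary T) (h : IsMarkovData lam T) {c : ℝ}
    (hc : 1 < c) : ∃ n₀, ∀ n ≥ n₀, ∀ x,
      F T x ≤ c * ∏ k ∈ Finset.range n, T k (x k) (x (k + 1)) / T (k + 1) (x k) (x (k + 1)) ∧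
      ∏ k ∈ Finset.range n, T k (x k) (x (k + 1)) / T (k + 1) (x k) (x (k + 1)) ≤ c * F T x := by
  obtain ⟨A, hA, hle⟩ := hq.exists_summable_bound
  -- The threshold depends only on the tail of `A`, hence not on the word; this is the uniformity.
  have hev := (tendsto_sum_nat_add A).eventually_lt_const (Real.log_pos hc)
  obtain ⟨n₀, hn₀⟩ := eventually_atTop.1 hev
  refine ⟨n₀, fun n hn x => ?_⟩
  set a : ℕ → ℝ := fun n => Real.log (T n (x n) (x (n + 1)) / T (n + 1) (x n) (x (n + 1))) with ha
  have hsum : Summable a := hq.summable_log x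
  have hP : ∏ k ∈ Finset.range n, T k (x k) (x (k + 1)) / T (k + 1) (x k) (x (k + 1)) =
      Real.exp (∑ k ∈ Finset.range n, a k) := by
    rw [Real.exp_sum]
    exact Finset.prod_congr rfl fun k _ =>
      (Real.exp_log (div_pos (h.T_pos _ _ _) (h.T_pos _ _ _))).symm
  have htail : |∑' k, a (k + n)| ≤ Real.log c := by
    refine le_trans ?_ (hn₀ n hn).le
    refine tsum_of_norm_bounded (f := fun k => a (k + n)) ((summable_nat_add_iff n).2 hA).hasSum fun k => ?_
    simpa using hle (k + n) _ _
  have hsplit := hsum.sum_add_tsum_nat_add n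
  obtain ⟨h1, h2⟩ := abs_le.1 htail
  rw [hP, hq.F_eq h x]
  change Real.exp (∑' k, a k) ≤ _ ∧ _ ≤ c * Real.exp (∑' k, a k)
  rw [← Real.exp_log (zero_lt_one.trans hc), ← Real.exp_add, ← Real.exp_add, Real.exp_le_exp,
    Real.exp_le_exp]
  constructor <;> linarith

lemma IsQuasiStationary.measurable_weight (hq : IsQuasiStationary T) (h : IsMarkovData lam T)
    (j : Fin N) : Measurable (weight lam T j) := by
  refine Measurable.ite (measurableSet_firstLetter j) ?_ measurable_const
  exact ((measurable_letters (fun a b => lam b / (lam a * T 0 a b)) 0 1).mul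
    ((hq.measurable_F h).comp measurable_shift)).sqrt

lemma weight_of_ne {j : Fin N} {x : Words N} (hx : x 0 ≠ j) : weight lam T j x = 0 := if_neg hx

lemma weight_nonneg (j : Fin N) (x : Words N) : 0 ≤ weight lam T j x := by
  unfold weight; split_ifs <;> positivity

lemma IsQuasiStationary.weight_sq (hq : IsQuasiStationary T) (h : IsMarkovData lam T)
    {j : Fin N} {x : Words N} (hx : x 0 = j) :
    weight lam T j x ^ 2 = lam (x 1) / (lam (x 0) * T 0 (x 0) (x 1)) * F T (shift x) := by
  rw [weight, if_pos hx, Real.sq_sqrt]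
  exact mul_nonneg (div_nonneg (h.lam_pos _).le (mul_pos (h.lam_pos _) (h.T_pos _ _ _)).le)
    (hq.F_pos h _).le

lemma IsQuasiStationary.weight_pos (hq : IsQuasiStationary T) (h : IsMarkovData lam T)
    {j : Fin N} {x : Words N} (hx : x 0 = j) : 0 < weight lam T j x := by
  rw [weight, if_pos hx]
  exact Real.sqrt_pos.2 (mul_pos (div_pos (h.lam_pos _) (mul_pos (h.lam_pos _) (h.T_pos _ _ _)))
    (hq.F_pos h _))

lemma cons_preimage_cylinder (x : Words N) (n : ℕ) :
    cons (x 0) ⁻¹' cylinder x (n + 1) = cylinder (shift x) n := by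
  rw [cylinder_succ]; ext y; simp

lemma cons_preimage_cylinder_of_ne {j : Fin N} {x : Words N} (hx : x 0 ≠ j) (n : ℕ) :
    cons j ⁻¹' cylinder x (n + 1) = ∅ := by
  rw [cylinder_succ]; ext y; simp [hx.symm]

/-- The denominators of the partial product cancel the later transitions of the longer cylinder.
This is why the weight has its particular form. -/
lemma cylinderMass_ratio (h : IsMarkovData lam T) (n : ℕ) (x : Words N) :
    lam (x 1) / (lam (x 0) * T 0 (x 0) (x 1)) *
      (∏ k ∈ Finset.range n, T k (shift x k) (shift x (k + 1)) /
        T (k + 1) (shift x k) (shift x (k + 1))) * cylinderMass lam T (n + 1) x =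
      cylinderMass lam T n (shift x) := by
  have h1 := (h.lam_pos (x 0)).ne'
  have h2 := (h.T_pos 0 (x 0) (x 1)).ne'
  have h3 : (∏ k ∈ Finset.range n, T (k + 1) (x (k + 1)) (x (k + 1 + 1))) ≠ 0 :=
    Finset.prod_ne_zero_iff.2 fun k _ => (h.T_pos _ _ _).ne'
  simp only [cylinderMass, shift_apply, Finset.prod_range_succ', Finset.prod_div_distrib, zero_add]
  field_simp

/-- Removes the multiplicative error `c` of the cylinder estimates, which hold only from a length
depending on `c`. -/
lemma measure_le_of_forall_one_lt {X : Type*} [MeasurableSpace X] {ν₁ ν₂ : Measure X}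
    [IsFiniteMeasure ν₂] (h : ∀ c : ℝ, 1 < c → ν₁ ≤ ENNReal.ofReal c • ν₂) : ν₁ ≤ ν₂ := by
  refine Measure.le_iff.2 fun B _ => ?_
  have ht : Tendsto (fun c : ℝ => ENNReal.ofReal c * ν₂ B) (𝓝[>] 1) (𝓝 (ENNReal.ofReal 1 * ν₂ B)) :=
    ENNReal.Tendsto.mul_const
      ((ENNReal.continuous_ofReal.tendsto 1).mono_left nhdsWithin_le_nhds)
      (Or.inr (measure_ne_top _ _))
  rw [ENNReal.ofReal_one, one_mul] at ht
  refine ge_of_tendsto ht ?_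
  filter_upwards [self_mem_nhdsWithin] with c hc
  exact h c hc B

/-- The square of the weight is the density, relative to `μ`, of the image of `μ` under the
branch `x ↦ jx` of the inverse of the shift. -/
theorem withDensity_weight (hμ : IsMarkovMeasure lam T μ) (h : IsMarkovData lam T)
    (hq : IsQuasiStationary T) (j : Fin N) :
    μ.withDensity (fun x => ENNReal.ofReal (weight lam T j x ^ 2)) = μ.map (cons j) := by
  have := hμ.isProbabilityMeasure h
  have hcyl : ∀ c : ℝ, 1 < c → ∃ n₀, ∀ n ≥ n₀, ∀ x,
      μ.withDensity (fun x => ENNReal.ofReal (weight lam T j x ^ 2)) (cylinder x n) ≤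
        (ENNReal.ofReal c • μ.map (cons j)) (cylinder x n) ∧
      μ.map (cons j) (cylinder x n) ≤ (ENNReal.ofReal c •
        μ.withDensity (fun x => ENNReal.ofReal (weight lam T j x ^ 2))) (cylinder x n) := by
    intro c hc
    have hc0 : 0 < c := zero_lt_one.trans hc
    obtain ⟨n₀, hn₀⟩ := hq.F_uniform h hc
    -- The first `n` transitions of `shift x` read the letters of `x` up to index `n + 1`, so they
    -- are constant on cylinders of length `n + 2`.
    refine ⟨n₀ + 2, fun m hm x => ?_⟩
    obtain ⟨n, rfl⟩ : ∃ n, m = n + 2 := ⟨m - 2, by omega⟩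
    rw [withDensity_apply _ (measurableSet_cylinder _ _), Measure.smul_apply, Measure.smul_apply,
      withDensity_apply _ (measurableSet_cylinder _ _),
      Measure.map_apply (measurable_cons j) (measurableSet_cylinder _ _)]
    by_cases hx : x 0 = j
    swap
    · rw [cons_preimage_cylinder_of_ne hx]
      refine ⟨le_of_eq_of_le ?_ zero_le, by simp⟩
      rw [setLIntegral_congr_fun (g := 0) (measurableSet_cylinder _ _)]
      · simp
      · intro y hy
        simp [weight_of_ne (lam := lam) (T := T) (j := j) (x := y) (by rw [hy 0 (by omega)]; exact hx)]
    subst hx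
    rw [cons_preimage_cylinder, hμ.cylinder]
    set d : ℝ := lam (x 1) / (lam (x 0) * T 0 (x 0) (x 1)) *
      (∏ k ∈ Finset.range n, T k (shift x k) (shift x (k + 1)) /
        T (k + 1) (shift x k) (shift x (k + 1))) with hd
    have hd0 : 0 ≤ d := mul_nonneg
      (div_nonneg (h.lam_pos _).le (mul_pos (h.lam_pos _) (h.T_pos _ _ _)).le)
      (Finset.prod_nonneg fun k _ => div_nonneg (h.T_pos _ _ _).le (h.T_pos _ _ _).le)
    have hdm : d * cylinderMass lam T (n + 1) x = cylinderMass lam T n (shift x) :=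
      cylinderMass_ratio h n x
    have hw : ∀ y ∈ cylinder x (n + 2), weight lam T (x 0) y ^ 2 ≤ c * d ∧
        d ≤ c * weight lam T (x 0) y ^ 2 := by
      intro y hy
      have e0 : y 0 = x 0 := hy 0 (by omega)
      have e1 : y 1 = x 1 := hy 1 (by omega)
      have hprod : ∏ k ∈ Finset.range n, T k (shift y k) (shift y (k + 1)) /
          T (k + 1) (shift y k) (shift y (k + 1)) = ∏ k ∈ Finset.range n,
          T k (shift x k) (shift x (k + 1)) / T (k + 1) (shift x k) (shift x (k + 1)) := by
        refine Finset.prod_congr rfl fun k hk => ?_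
        have := Finset.mem_range.1 hk
        simp only [shift_apply]
        rw [hy (k + 1) (by omega), hy (k + 1 + 1) (by omega)]
      obtain ⟨b1, b2⟩ := hn₀ n (by omega) (shift y)
      rw [hprod] at b1 b2
      have hr : 0 ≤ lam (x 1) / (lam (x 0) * T 0 (x 0) (x 1)) :=
        div_nonneg (h.lam_pos _).le (mul_pos (h.lam_pos _) (h.T_pos _ _ _)).le
      rw [hq.weight_sq h e0, e0, e1, hd]
      constructor
      · calc _ ≤ _ := mul_le_mul_of_nonneg_left b1 hr
          _ = _ := by ring
      · calc _ ≤ _ := mul_le_mul_of_nonneg_left b2 hr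
          _ = _ := by ring
    constructor
    · calc ∫⁻ y in cylinder x (n + 2), ENNReal.ofReal (weight lam T (x 0) y ^ 2) ∂μ
          ≤ ∫⁻ _ in cylinder x (n + 2), ENNReal.ofReal (c * d) ∂μ :=
            setLIntegral_mono measurable_const fun y hy => ENNReal.ofReal_le_ofReal (hw y hy).1
        _ = ENNReal.ofReal (c * d) * ENNReal.ofReal (cylinderMass lam T (n + 1) x) := by
            rw [setLIntegral_const, hμ.cylinder]
        _ = ENNReal.ofReal c • ENNReal.ofReal (cylinderMass lam T n (shift x)) := by
            rw [smul_eq_mul, ← ENNReal.ofReal_mul (by positivity), ← ENNReal.ofReal_mul hc0.le,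
              ← hdm, mul_assoc]
    · calc ENNReal.ofReal (cylinderMass lam T n (shift x))
          = ∫⁻ _ in cylinder x (n + 2), ENNReal.ofReal d ∂μ := by
            rw [setLIntegral_const, hμ.cylinder, ← ENNReal.ofReal_mul hd0, hdm]
        _ ≤ ∫⁻ y in cylinder x (n + 2),
              ENNReal.ofReal c * ENNReal.ofReal (weight lam T (x 0) y ^ 2) ∂μ := by
            refine setLIntegral_mono
              (((hq.measurable_weight h _).pow_const 2).ennreal_ofReal.const_mul _) fun y hy => ?_
            rw [← ENNReal.ofReal_mul hc0.le]
            exact ENNReal.ofReal_le_ofReal (hw y hy).2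
        _ = _ := by
            rw [lintegral_const_mul _ ((hq.measurable_weight h _).pow_const 2).ennreal_ofReal,
              smul_eq_mul]
  have hmap : IsFiniteMeasure (μ.map (cons j)) := inferInstance
  -- Finiteness comes from the cylinder estimate with `c = 2`, summed over all cylinders of one
  -- length.
  have hfin : IsFiniteMeasure
      (μ.withDensity fun x => ENNReal.ofReal (weight lam T j x ^ 2)) := by
    constructor
    obtain ⟨n₀, hn₀⟩ := hcyl 2 one_lt_two
    have := measure_le_of_cylinder (n := n₀) (fun x => (hn₀ n₀ le_rfl x).1) Set.univ
    rw [Set.preimage_univ] at this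
    refine this.trans_lt ?_
    rw [Measure.smul_apply, smul_eq_mul]
    exact ENNReal.mul_lt_top ENNReal.ofReal_lt_top (measure_lt_top _ _)
  refine le_antisymm (measure_le_of_forall_one_lt fun c hc => ?_)
    (measure_le_of_forall_one_lt fun c hc => ?_)
  · obtain ⟨n₀, hn₀⟩ := hcyl c hc
    have := Measure.smul_finite (μ.map (cons j)) (c := ENNReal.ofReal c) ENNReal.ofReal_ne_top
    exact measure_le_of_forall_cylinder n₀ fun n hn x => (hn₀ n hn x).1
  · obtain ⟨n₀, hn₀⟩ := hcyl c hc
    have := Measure.smul_finite (μ.withDensity fun x => ENNReal.ofReal (weight lam T j x ^ 2))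
      (c := ENNReal.ofReal c) ENNReal.ofReal_ne_top
    exact measure_le_of_forall_cylinder n₀ fun n hn x => (hn₀ n hn x).2

end QSMarkov

/-! ### Ergodicity, nonsingularity and the dichotomy for measures. -/

namespace QSMarkov

open PiNat (cylinder)
open Filter Topology

variable {N : ℕ} {lam : Fin N → ℝ} {T : ℕ → Matrix (Fin N) (Fin N) ℝ} {μ : Measure (Words N)}

lemma cylinderMass_concat (n m : ℕ) (x y : Words N) :
    cylinderMass lam T (n + 1 + m) (concat (n + 1) x y) =
      cylinderMass lam T n x *
        (T n (x n) (y 0) * ∏ k ∈ Finset.range m, T (n + 1 + k) (y k) (y (k + 1))) := by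
  have h1 : ∏ k ∈ Finset.range n, T k (concat (n + 1) x y k) (concat (n + 1) x y (k + 1)) =
      ∏ k ∈ Finset.range n, T k (x k) (x (k + 1)) := by
    refine Finset.prod_congr rfl fun k hk => ?_
    have := Finset.mem_range.1 hk
    simp only [concat]
    rw [if_pos (by omega), if_pos (by omega)]
  have h2 : ∏ k ∈ Finset.range m, T (n + 1 + k) (concat (n + 1) x y (n + 1 + k))
        (concat (n + 1) x y (n + 1 + k + 1)) =
      ∏ k ∈ Finset.range m, T (n + 1 + k) (y k) (y (k + 1)) := by
    refine Finset.prod_congr rfl fun k _ => ?_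
    simp only [concat]
    rw [if_neg (by omega), if_neg (by omega), show n + 1 + k - (n + 1) = k by omega,
      show n + 1 + k + 1 - (n + 1) = k + 1 by omega]
  rw [cylinderMass, Finset.prod_range_add, Finset.prod_range_succ, h1, h2, cylinderMass]
  simp [concat]
  ring

lemma measurable_iterate_shift (n : ℕ) : Measurable (shift^[n] : Words N → Words N) :=
  measurable_shift.iterate n

/-- The past and the future of the process are comparable to independent ones. -/
lemma mul_measure_le_measure_inter (hμ : IsMarkovMeasure lam T μ) (h : IsMarkovData lam T)
    {ε : ℝ} (hε : 0 < ε) (hT : ∀ n i j, ε ≤ T n i j) (n : ℕ) (x : Words N) {B : Set (Words N)}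
    (hB : MeasurableSet B) :
    ENNReal.ofReal ε * μ (cylinder x (n + 1)) * μ (shift^[n + 1] ⁻¹' B) ≤
      μ (cylinder x (n + 1) ∩ shift^[n + 1] ⁻¹' B) := by
  have := hμ.isProbabilityMeasure h
  have hs := measurable_iterate_shift (N := N) (n + 1)
  set a : ℝ≥0∞ := ENNReal.ofReal ε * μ (cylinder x (n + 1)) with ha
  have ha_top : a ≠ ∞ := ENNReal.mul_ne_top ENNReal.ofReal_ne_top (measure_ne_top _ _)
  have := Measure.smul_finite (μ.map shift^[n + 1]) ha_top
  have key : a • μ.map shift^[n + 1] ≤ (μ.restrict (cylinder x (n + 1))).map shift^[n + 1] := by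
    refine measure_le_of_forall_cylinder 1 fun m hm y => ?_
    obtain ⟨m, rfl⟩ : ∃ m', m = m' + 1 := ⟨m - 1, by omega⟩
    have hC := measurableSet_cylinder y (m + 1)
    rw [Measure.smul_apply, Measure.map_apply hs hC, Measure.map_apply hs hC,
      Measure.restrict_apply (hs hC), Set.inter_comm, ← cylinder_concat, smul_eq_mul]
    set q : ℝ := ∏ k ∈ Finset.range m, T (n + 1 + k) (y k) (y (k + 1)) with hq
    have hq0 : 0 ≤ q := Finset.prod_nonneg fun k _ => (h.T_pos _ _ _).le
    have hval : ∀ z, μ (cylinder (concat (n + 1) z y) (n + 1 + (m + 1))) =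
        ENNReal.ofReal (cylinderMass lam T n z * (T n (z n) (y 0) * q)) := fun z => by
      rw [← add_assoc, hμ.cylinder, cylinderMass_concat]
    -- Only the transition linking past to future couples them. Here it is bounded above by `1`;
    -- below, for the given past, it is bounded from below by `ε`.
    have hle : μ (shift^[n + 1] ⁻¹' cylinder y (m + 1)) ≤ ENNReal.ofReal q := by
      have := measure_le_of_cylinder (n := n + 1)
        (ν₁ := (μ.restrict (shift^[n + 1] ⁻¹' cylinder y (m + 1))))
        (ν₂ := ENNReal.ofReal q • μ) (fun z => ?_) Set.univ
      · simpa using this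
      rw [Measure.restrict_apply (measurableSet_cylinder _ _), ← cylinder_concat, hval,
        Measure.smul_apply, hμ.cylinder, smul_eq_mul, ← ENNReal.ofReal_mul hq0]
      refine ENNReal.ofReal_le_ofReal ?_
      have h1 := h.T_le_one n (z n) (y 0)
      have h2 := (h.cylinderMass_pos n z).le
      calc _ ≤ cylinderMass lam T n z * (1 * q) := by gcongr
        _ = _ := by ring
    rw [hval]
    calc a * μ (shift^[n + 1] ⁻¹' cylinder y (m + 1)) ≤ a * ENNReal.ofReal q := by gcongr
      _ = ENNReal.ofReal (cylinderMass lam T n x * (ε * q)) := by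
          rw [ha, hμ.cylinder, ← ENNReal.ofReal_mul hε.le, ← ENNReal.ofReal_mul]
          · congr 1; ring
          · exact mul_nonneg hε.le (h.cylinderMass_pos n x).le
      _ ≤ _ := by
          refine ENNReal.ofReal_le_ofReal ?_
          have h2 := (h.cylinderMass_pos n x).le
          have := hT n (x n) (y 0)
          gcongr
  have := key B
  rwa [Measure.smul_apply, Measure.map_apply hs hB, Measure.map_apply hs hB,
    Measure.restrict_apply (hs hB), Set.inter_comm, smul_eq_mul] at this

/-- The shift is ergodic for a quasi-stationary Markov measure. -/
theorem measure_eq_zero_or_compl_of_shift_invariant (hμ : IsMarkovMeasure lam T μ)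
    (h : IsMarkovData lam T) (hq : IsQuasiStationary T) {A : Set (Words N)}
    (hA : MeasurableSet A) (hinv : shift ⁻¹' A = A) : μ A = 0 ∨ μ Aᶜ = 0 := by
  have := hμ.isProbabilityMeasure h
  obtain ⟨ε, hε, hT⟩ := hq.exists_lower_bound h
  have hit : ∀ n, shift^[n] ⁻¹' A = A := fun n => by
    induction n with
    | zero => rfl
    | succ n ih => rw [Function.iterate_succ, Set.preimage_comp, ih, hinv]
  have hc : ENNReal.ofReal ε * μ A ≠ ∞ :=
    ENNReal.mul_ne_top ENNReal.ofReal_ne_top (measure_ne_top _ _)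
  have := Measure.smul_finite μ hc
  have key : (ENNReal.ofReal ε * μ A) • μ ≤ μ.restrict A := by
    refine measure_le_of_forall_cylinder 1 fun m hm x => ?_
    obtain ⟨n, rfl⟩ : ∃ n, m = n + 1 := ⟨m - 1, by omega⟩
    have := mul_measure_le_measure_inter hμ h hε hT n x hA
    rw [hit] at this
    rw [Measure.smul_apply, Measure.restrict_apply (measurableSet_cylinder _ _), smul_eq_mul]
    calc _ = _ := by ring
      _ ≤ _ := this
  -- On the complement the right side vanishes, so `ε μ(A) μ(Aᶜ) = 0`.
  have h0 := key Aᶜ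
  rw [Measure.smul_apply, Measure.restrict_apply hA.compl, Set.compl_inter_self, measure_empty,
    smul_eq_mul, nonpos_iff_eq_zero, mul_eq_zero, mul_eq_zero, ENNReal.ofReal_eq_zero] at h0
  rcases h0 with (h0 | h0) | h0
  · exact absurd h0 (not_le.2 hε)
  · exact .inl h0
  · exact .inr h0

/-- The shift is nonsingular. -/
lemma measure_shift_preimage_eq_zero (hμ : IsMarkovMeasure lam T μ) (h : IsMarkovData lam T)
    (hq : IsQuasiStationary T) {A : Set (Words N)} (hA : MeasurableSet A) (h0 : μ A = 0) :
    μ (shift ⁻¹' A) = 0 := by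
  have hcover : shift ⁻¹' A = ⋃ j : Fin N, firstLetter j ∩ shift ⁻¹' A := by
    ext x; simp
  rw [hcover, measure_iUnion_null_iff]
  intro j
  have hw := (((hq.measurable_weight h j).pow_const 2).ennreal_ofReal)
  have h1 : μ.withDensity (fun x => ENNReal.ofReal (weight lam T j x ^ 2)) (shift ⁻¹' A) = 0 := by
    rw [withDensity_weight hμ h hq, Measure.map_apply (measurable_cons j) (measurable_shift hA)]
    exact h0
  rw [withDensity_apply_eq_zero hw] at h1
  refine measure_mono_null ?_ h1
  rintro x ⟨hx, hxA⟩
  refine ⟨?_, hxA⟩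
  have := hq.weight_pos h (mem_firstLetter.1 hx)
  simp only [Set.mem_ofPred_eq, ne_eq, ENNReal.ofReal_eq_zero, not_le]
  positivity

lemma measure_cons_preimage_eq_zero (hμ : IsMarkovMeasure lam T μ) (h : IsMarkovData lam T)
    (hq : IsQuasiStationary T) (j : Fin N) {A : Set (Words N)} (hA : MeasurableSet A)
    (h0 : μ A = 0) : μ (cons j ⁻¹' A) = 0 := by
  rw [← Measure.map_apply (measurable_cons j) hA, ← withDensity_weight hμ h hq]
  exact withDensity_absolutelyContinuous _ _ h0

/-- Every null set is contained in a shift-invariant null set. -/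
lemma exists_shift_invariant_null (hμ : IsMarkovMeasure lam T μ) (h : IsMarkovData lam T)
    (hq : IsQuasiStationary T) {A : Set (Words N)} (hA : MeasurableSet A) (h0 : μ A = 0) :
    ∃ B, A ⊆ B ∧ MeasurableSet B ∧ shift ⁻¹' B = B ∧ μ B = 0 := by
  -- `C m` is the forward image of `A` under the `m`-th iterate of the shift, written with inverse
  -- branches so that it is visibly measurable and null.
  let C : ℕ → Set (Words N) := fun m => Nat.rec A (fun _ B => ⋃ j : Fin N, cons j ⁻¹' B) m
  have hCm : ∀ m, MeasurableSet (C m) ∧ μ (C m) = 0 := by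
    intro m
    induction m with
    | zero => exact ⟨hA, h0⟩
    | succ m ih =>
      exact ⟨MeasurableSet.iUnion fun j => measurable_cons j ih.1,
        measure_iUnion_null fun j => measure_cons_preimage_eq_zero hμ h hq j ih.1 ih.2⟩
  have hCs : ∀ m x, x ∈ C m → shift x ∈ C (m + 1) := fun m x hx =>
    Set.mem_iUnion.2 ⟨x 0, by rw [Set.mem_preimage, cons_shift]; exact hx⟩
  let D : ℕ → Set (Words N) := fun n => shift^[n] ⁻¹' ⋃ m, C m
  have hDs : ∀ n, D (n + 1) = shift ⁻¹' D n := fun n => by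
    change shift^[n + 1] ⁻¹' _ = shift ⁻¹' (shift^[n] ⁻¹' _)
    rw [Function.iterate_succ, Set.preimage_comp]
  have hDm : ∀ n, MeasurableSet (D n) ∧ μ (D n) = 0 := by
    intro n
    induction n with
    | zero => exact ⟨MeasurableSet.iUnion fun m => (hCm m).1, measure_iUnion_null fun m => (hCm m).2⟩
    | succ n ih =>
      rw [hDs]
      exact ⟨measurable_shift ih.1, measure_shift_preimage_eq_zero hμ h hq ih.1 ih.2⟩
  -- The union of the forward images is mapped into itself by the shift. Hence its preimages
  -- increase, and their union is exactly invariant, not only up to null sets.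
  have hD01 : D 0 ⊆ D 1 := by
    intro x hx
    obtain ⟨m, hm⟩ := Set.mem_iUnion.1 hx
    exact Set.mem_iUnion.2 ⟨m + 1, hCs m x hm⟩
  have hmono : ∀ n, D n ⊆ D (n + 1) := by
    intro n
    induction n with
    | zero => exact hD01
    | succ n ih => rw [hDs n, hDs (n + 1)]; exact Set.preimage_mono ih
  refine ⟨⋃ n, D n, ?_, MeasurableSet.iUnion fun n => (hDm n).1, ?_,
    measure_iUnion_null fun n => (hDm n).2⟩
  · exact fun x hx => Set.mem_iUnion.2 ⟨0, Set.mem_iUnion.2 ⟨0, hx⟩⟩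
  · rw [Set.preimage_iUnion]
    simp_rw [← hDs]
    refine subset_antisymm (Set.iUnion_subset fun n => Set.subset_iUnion D (n + 1))
      (Set.iUnion_mono hmono)

variable {lam' : Fin N → ℝ} {T' : ℕ → Matrix (Fin N) (Fin N) ℝ} {μ' : Measure (Words N)}

lemma absolutelyContinuous_or_mutuallySingular
    (hμ : IsMarkovMeasure lam T μ) (h : IsMarkovData lam T) (hq : IsQuasiStationary T)
    (hμ' : IsMarkovMeasure lam' T' μ') (h' : IsMarkovData lam' T') (hq' : IsQuasiStationary T') :
    μ' ≪ μ ∨ μ ⟂ₘ μ' := by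
  by_cases hac : μ' ≪ μ
  · exact .inl hac
  refine .inr ?_
  obtain ⟨A, hA, h0, hA'⟩ : ∃ A, MeasurableSet A ∧ μ A = 0 ∧ μ' A ≠ 0 := by
    by_contra! hcon
    exact hac (Measure.AbsolutelyContinuous.mk fun s hs h0 => hcon s hs h0)
  obtain ⟨B, hAB, hB, hinv, hB0⟩ := exists_shift_invariant_null hμ h hq hA h0
  rcases measure_eq_zero_or_compl_of_shift_invariant hμ' h' hq' hB hinv with h1 | h1
  · exact absurd (measure_mono_null hAB h1) hA'
  · exact ⟨B, hB, hB0, h1⟩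

/-- Two quasi-stationary Markov measures are equivalent or mutually singular. -/
theorem equivalent_or_mutuallySingular
    (hμ : IsMarkovMeasure lam T μ) (h : IsMarkovData lam T) (hq : IsQuasiStationary T)
    (hμ' : IsMarkovMeasure lam' T' μ') (h' : IsMarkovData lam' T') (hq' : IsQuasiStationary T') :
    (μ ≪ μ' ∧ μ' ≪ μ) ∨ μ ⟂ₘ μ' := by
  rcases absolutelyContinuous_or_mutuallySingular hμ h hq hμ' h' hq' with h1 | h1
  · rcases absolutelyContinuous_or_mutuallySingular hμ' h' hq' hμ h hq with h2 | h2
    · exact .inl ⟨h2, h1⟩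
    · exact .inr h2.symm
  · exact .inr h1

end QSMarkov

/-! ### Weighted composition operators between `L²` spaces. -/

namespace QSMarkov

open PiNat (cylinder)
open Filter Topology

section WeightedComposition

variable {X Y : Type*} [MeasurableSpace X] [MeasurableSpace Y]

/-- The data of a weighted composition operator `f ↦ w · (f ∘ s)` from `L²(μ)` to `L²(ν)` of norm
at most `1`. -/
structure IsContractiveWeight (s : X → Y) (w : X → ℝ) (ν : Measure X) (μ : Measure Y) : Prop where
  measurable_map : Measurable s
  measurable_weight : Measurable w
  map_le : (ν.withDensity fun x => ENNReal.ofReal (w x ^ 2)).map s ≤ μ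

lemma enorm_ofReal_mul_sq (r : ℝ) (z : ℂ) :
    ‖(r : ℂ) * z‖ₑ ^ 2 = ENNReal.ofReal (r ^ 2) * ‖z‖ₑ ^ 2 := by
  rw [enorm_mul, mul_pow]
  congr 1
  rw [← ofReal_norm, ← ENNReal.ofReal_pow (norm_nonneg _), Complex.norm_real,
    Real.norm_eq_abs, sq_abs]

lemma eLpNorm_two_sq (f : X → ℂ) (ν : Measure X) :
    eLpNorm f 2 ν ^ 2 = ∫⁻ x, ‖f x‖ₑ ^ 2 ∂ν := by
  have := eLpNorm_nnreal_pow_eq_lintegral (f := f) (μ := ν) (p := 2) two_ne_zero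
  simpa using this

lemma enorm_Lp_sq {ν : Measure X} (f : Lp ℂ 2 ν) : ‖f‖ₑ ^ 2 = ∫⁻ x, ‖f x‖ₑ ^ 2 ∂ν := by
  rw [Lp.enorm_def, eLpNorm_two_sq]

variable {s : X → Y} {w : X → ℝ} {ν : Measure X} {μ : Measure Y}

namespace IsContractiveWeight

lemma lintegral_eq (hw : IsContractiveWeight s w ν μ) {f : Y → ℂ} (hf : StronglyMeasurable f) :
    ∫⁻ x, ‖(w x : ℂ) * f (s x)‖ₑ ^ 2 ∂ν =
      ∫⁻ y, ‖f y‖ₑ ^ 2 ∂(ν.withDensity fun x => ENNReal.ofReal (w x ^ 2)).map s := by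
  have hm : Measurable fun y => ‖f y‖ₑ ^ 2 := (hf.measurable.enorm).pow_const 2
  rw [lintegral_map hm hw.measurable_map]
  refine Eq.trans ?_ (lintegral_withDensity_eq_lintegral_mul _
    (hw.measurable_weight.pow_const 2).ennreal_ofReal (hm.comp hw.measurable_map)).symm
  simp only [enorm_ofReal_mul_sq, Pi.mul_apply, Function.comp_apply]

lemma eLpNorm_le (hw : IsContractiveWeight s w ν μ) {f : Y → ℂ} (hf : StronglyMeasurable f) :
    eLpNorm (fun x => (w x : ℂ) * f (s x)) 2 ν ≤ eLpNorm f 2 μ := by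
  rw [← ENNReal.pow_le_pow_left_iff two_ne_zero, eLpNorm_two_sq, eLpNorm_two_sq,
    hw.lintegral_eq hf]
  exact lintegral_mono' hw.map_le le_rfl

/-- Makes the operator well defined on classes: `s` itself need not be nonsingular, since points
where `w` vanishes do not matter. -/
lemma ae_eq (hw : IsContractiveWeight s w ν μ) {f g : Y → ℂ} (hfg : f =ᵐ[μ] g) :
    (fun x => (w x : ℂ) * f (s x)) =ᵐ[ν] fun x => (w x : ℂ) * g (s x) := by
  have h1 : f =ᵐ[(ν.withDensity fun x => ENNReal.ofReal (w x ^ 2)).map s] g :=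
    (Measure.absolutelyContinuous_of_le hw.map_le).ae_eq hfg
  have h2 := ae_of_ae_map hw.measurable_map.aemeasurable h1
  rw [ae_withDensity_iff (hw.measurable_weight.pow_const 2).ennreal_ofReal] at h2
  filter_upwards [h2] with x hx
  by_cases h0 : w x = 0
  · simp [h0]
  · rw [hx]
    simp only [ne_eq, ENNReal.ofReal_eq_zero, not_le]
    positivity

lemma memLp (hw : IsContractiveWeight s w ν μ) (f : Lp ℂ 2 μ) :
    MemLp (fun x => (w x : ℂ) * f (s x)) 2 ν :=
  ⟨((Complex.measurable_ofReal.comp hw.measurable_weight).mul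
      ((Lp.stronglyMeasurable f).measurable.comp hw.measurable_map)).aestronglyMeasurable,
    (hw.eLpNorm_le (Lp.stronglyMeasurable f)).trans_lt (Lp.eLpNorm_lt_top f)⟩

/-- The weighted composition operator `f ↦ w · (f ∘ s)`. -/
noncomputable def op (hw : IsContractiveWeight s w ν μ) : Lp ℂ 2 μ →L[ℂ] Lp ℂ 2 ν :=
  LinearMap.mkContinuous
    { toFun := fun f => (hw.memLp f).toLp
      map_add' := fun f g => by
        rw [← MemLp.toLp_add, MemLp.toLp_eq_toLp_iff]
        filter_upwards [hw.ae_eq (Lp.coeFn_add f g)] with x hx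
        rw [hx]
        simp [mul_add]
      map_smul' := fun c f => by
        rw [RingHom.id_apply, ← MemLp.toLp_const_smul, MemLp.toLp_eq_toLp_iff]
        filter_upwards [hw.ae_eq (Lp.coeFn_smul c f)] with x hx
        rw [hx]
        simp [mul_left_comm] } 1 fun f => by
    rw [one_mul]
    change ‖(hw.memLp f).toLp‖ ≤ ‖f‖
    rw [Lp.norm_toLp, Lp.norm_def]
    exact ENNReal.toReal_mono (Lp.eLpNorm_ne_top f) (hw.eLpNorm_le (Lp.stronglyMeasurable f))

lemma coeFn_op (hw : IsContractiveWeight s w ν μ) (f : Lp ℂ 2 μ) :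
    (hw.op f : X → ℂ) =ᵐ[ν] fun x => (w x : ℂ) * f (s x) :=
  (hw.memLp f).coeFn_toLp

lemma norm_op (hw : IsContractiveWeight s w ν μ)
    (heq : (ν.withDensity fun x => ENNReal.ofReal (w x ^ 2)).map s = μ) (f : Lp ℂ 2 μ) :
    ‖hw.op f‖ = ‖f‖ := by
  change ‖(hw.memLp f).toLp‖ = ‖f‖
  rw [Lp.norm_toLp, Lp.norm_def]
  congr 1
  rw [← (ENNReal.pow_right_strictMono two_ne_zero).injective.eq_iff]
  rw [ eLpNorm_two_sq, eLpNorm_two_sq,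
    hw.lintegral_eq (Lp.stronglyMeasurable f), heq]

end IsContractiveWeight

lemma isContractiveWeight_indicator {B : Set X} (hB : MeasurableSet B) (ν : Measure X) :
    IsContractiveWeight id (B.indicator fun _ => (1 : ℝ)) ν ν where
  measurable_map := measurable_id
  measurable_weight := measurable_const.indicator hB
  map_le := by
    rw [Measure.map_id]
    refine (withDensity_mono (ae_of_all _ fun x => ?_)).trans_eq withDensity_one
    by_cases hx : x ∈ B <;> simp [hx]

/-- Multiplication by the indicator function of `B` on `L²(ν)`. -/
noncomputable def indicatorOp (ν : Measure X) {B : Set X} (hB : MeasurableSet B) :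
    Lp ℂ 2 ν →L[ℂ] Lp ℂ 2 ν :=
  (isContractiveWeight_indicator hB ν).op

lemma coeFn_indicatorOp {B : Set X} (hB : MeasurableSet B) (f : Lp ℂ 2 ν) :
    (indicatorOp ν hB f : X → ℂ) =ᵐ[ν] B.indicator f := by
  filter_upwards [(isContractiveWeight_indicator hB ν).coeFn_op f] with x hx
  rw [indicatorOp, hx]
  by_cases h : x ∈ B <;> simp [h]

lemma enorm_indicatorOp_sq {B : Set X} (hB : MeasurableSet B) (f : Lp ℂ 2 ν) :
    ‖indicatorOp ν hB f‖ₑ ^ 2 = ∫⁻ x in B, ‖f x‖ₑ ^ 2 ∂ν := by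
  rw [enorm_Lp_sq, ← lintegral_indicator hB]
  refine lintegral_congr_ae ?_
  filter_upwards [coeFn_indicatorOp hB f] with x hx
  rw [hx]
  by_cases h : x ∈ B <;> simp [h]

lemma isContractiveWeight_density {ρ : Measure X} {g : X → ℝ}
    (hg : Measurable g) (hd : ν.withDensity (fun x => ENNReal.ofReal (g x ^ 2)) = ρ) :
    IsContractiveWeight id g ν ρ where
  measurable_map := measurable_id
  measurable_weight := hg
  map_le := by rw [Measure.map_id, hd]

lemma withDensity_sqrt_rnDeriv {ρ : Measure X} [IsFiniteMeasure ρ] [IsFiniteMeasure ν]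
    (hac : ρ ≪ ν) :
    ν.withDensity (fun x => ENNReal.ofReal (√(ρ.rnDeriv ν x).toReal ^ 2)) = ρ := by
  conv_rhs => rw [← Measure.withDensity_rnDeriv_eq ρ ν hac]
  refine withDensity_congr_ae ?_
  filter_upwards [ρ.rnDeriv_lt_top ν] with x hx
  rw [Real.sq_sqrt ENNReal.toReal_nonneg, ENNReal.ofReal_toReal hx.ne]

lemma sqrt_rnDeriv_mul_sqrt_rnDeriv {ρ : Measure X} [IsFiniteMeasure ρ] [IsFiniteMeasure ν]
    (hac : ν ≪ ρ) :
    ∀ᵐ x ∂ν, √(ρ.rnDeriv ν x).toReal * √(ν.rnDeriv ρ x).toReal = 1 := by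
  filter_upwards [Measure.inv_rnDeriv hac, Measure.rnDeriv_pos hac,
    hac.ae_le (ν.rnDeriv_lt_top ρ)] with x h1 h2 h3
  have hpos := ENNReal.toReal_pos h2.ne' h3.ne
  rw [← h1, Pi.inv_apply, ENNReal.toReal_inv, Real.sqrt_inv]
  exact inv_mul_cancel₀ (Real.sqrt_pos.2 hpos).ne'

end WeightedComposition

/-! ### The representations and their intertwiners. -/

section Cuntz

variable {N : ℕ} {lam : Fin N → ℝ} {T : ℕ → Matrix (Fin N) (Fin N) ℝ} {μ : Measure (Words N)}

lemma map_shift_withDensity_weight (hμ : IsMarkovMeasure lam T μ) (h : IsMarkovData lam T)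
    (hq : IsQuasiStationary T) (j : Fin N) :
    (μ.withDensity fun x => ENNReal.ofReal (weight lam T j x ^ 2)).map shift = μ := by
  rw [withDensity_weight hμ h hq, Measure.map_map measurable_shift (measurable_cons j)]
  exact Measure.map_id

lemma isContractiveWeight_weight (hμ : IsMarkovMeasure lam T μ) (h : IsMarkovData lam T)
    (hq : IsQuasiStationary T) (j : Fin N) : IsContractiveWeight shift (weight lam T j) μ μ where
  measurable_map := measurable_shift
  measurable_weight := hq.measurable_weight h j
  map_le := (map_shift_withDensity_weight hμ h hq j).le

/-- Transported by `cons j`, the squared reciprocal weight meets the density `weight ^ 2`; the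
product is `1` where the weight is nonzero and `0` elsewhere. -/
lemma isContractiveWeight_cons (hμ : IsMarkovMeasure lam T μ) (h : IsMarkovData lam T)
    (hq : IsQuasiStationary T) (j : Fin N) :
    IsContractiveWeight (cons j) (fun x => (weight lam T j (cons j x))⁻¹) μ μ where
  measurable_map := measurable_cons j
  measurable_weight := ((hq.measurable_weight h j).comp (measurable_cons j)).inv
  map_le := by
    have hw := hq.measurable_weight h j
    have hv : Measurable fun x => ENNReal.ofReal ((weight lam T j x)⁻¹ ^ 2) :=
      (hw.inv.pow_const 2).ennreal_ofReal
    refine Measure.le_iff.2 fun B hB => ?_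
    rw [Measure.map_apply (measurable_cons j) hB,
      withDensity_apply _ (measurable_cons j hB)]
    rw [← setLIntegral_map hB hv (measurable_cons j), ← withDensity_weight hμ h hq,
      setLIntegral_withDensity_eq_setLIntegral_mul _ (hw.pow_const 2).ennreal_ofReal hv hB]
    calc _ ≤ ∫⁻ _ in B, 1 ∂μ := lintegral_mono fun x => ?_
      _ = μ B := by simp
    rw [Pi.mul_apply, ← ENNReal.ofReal_mul (sq_nonneg _), ← mul_pow, ← ENNReal.ofReal_one]
    refine ENNReal.ofReal_le_ofReal ?_
    by_cases h0 : weight lam T j x = 0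
    · simp [h0]
    · simp [h0]

/-- The operator `S_j` of the representation associated to a quasi-stationary Markov measure. -/
noncomputable def branchOp (hμ : IsMarkovMeasure lam T μ) (h : IsMarkovData lam T)
    (hq : IsQuasiStationary T) (j : Fin N) : Lp ℂ 2 μ →L[ℂ] Lp ℂ 2 μ :=
  (isContractiveWeight_weight hμ h hq j).op

/-- The operator that turns out to be the adjoint of `S_j`. -/
noncomputable def branchCoOp (hμ : IsMarkovMeasure lam T μ) (h : IsMarkovData lam T)
    (hq : IsQuasiStationary T) (j : Fin N) : Lp ℂ 2 μ →L[ℂ] Lp ℂ 2 μ :=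
  (isContractiveWeight_cons hμ h hq j).op

lemma branchOp_comp_branchCoOp (hμ : IsMarkovMeasure lam T μ) (h : IsMarkovData lam T)
    (hq : IsQuasiStationary T) (j : Fin N) :
    branchOp hμ h hq j ∘L branchCoOp hμ h hq j = indicatorOp μ (measurableSet_firstLetter j) := by
  ext1 f
  refine Lp.ext ?_
  have hS := isContractiveWeight_weight hμ h hq j
  have hR := isContractiveWeight_cons hμ h hq j
  filter_upwards [hS.coeFn_op (hR.op f), hS.ae_eq (hR.coeFn_op f),
    coeFn_indicatorOp (measurableSet_firstLetter j) f] with x h1 h2 h3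
  rw [h3]
  change (hS.op (hR.op f)) x = _
  rw [h1, h2]
  by_cases hx : x 0 = j
  · rw [Set.indicator_of_mem (mem_firstLetter.2 hx)]
    subst hx
    rw [cons_shift]
    have := (hq.weight_pos h (j := x 0) (x := x) rfl).ne'
    push_cast
    rw [mul_inv_cancel_left₀ (by exact_mod_cast this)]
  · rw [Set.indicator_of_notMem (by simpa using hx), weight_of_ne hx]
    simp

lemma branchOp_comp_indicatorOp (hμ : IsMarkovMeasure lam T μ) (h : IsMarkovData lam T)
    (hq : IsQuasiStationary T) (j : Fin N) {B : Set (Words N)} (hB : MeasurableSet B) :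
    branchOp hμ h hq j ∘L indicatorOp μ hB =
      indicatorOp μ (measurable_shift hB) ∘L branchOp hμ h hq j := by
  ext1 f
  refine Lp.ext ?_
  have hS := isContractiveWeight_weight hμ h hq j
  filter_upwards [hS.coeFn_op (indicatorOp μ hB f), hS.ae_eq (coeFn_indicatorOp hB f),
    coeFn_indicatorOp (measurable_shift hB) (hS.op f), hS.coeFn_op f] with x h1 h2 h3 h4
  change (hS.op (indicatorOp μ hB f)) x = (indicatorOp μ (measurable_shift hB) (hS.op f)) x
  rw [h1, h2, h3]
  by_cases hx : shift x ∈ B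
  · rw [Set.indicator_of_mem hx, Set.indicator_of_mem (by exact hx), h4]
  · rw [Set.indicator_of_notMem hx, Set.indicator_of_notMem (by exact hx), mul_zero]

lemma indicatorOp_comp_indicatorOp {X : Type*} [MeasurableSpace X] {ν : Measure X} {A B : Set X}
    (hA : MeasurableSet A) (hB : MeasurableSet B) :
    indicatorOp ν hA ∘L indicatorOp ν hB = indicatorOp ν (hB.inter hA) := by
  ext1 f
  refine Lp.ext ?_
  filter_upwards [coeFn_indicatorOp hA (indicatorOp ν hB f), coeFn_indicatorOp hB f,
    coeFn_indicatorOp (hB.inter hA) f] with x h1 h2 h3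
  rw [ContinuousLinearMap.comp_apply, h1, h3]
  by_cases hx : x ∈ A <;> by_cases hx' : x ∈ B <;> simp [hx, hx', h2]

lemma sum_indicatorOp_firstLetter :
    ∑ j : Fin N, indicatorOp μ (measurableSet_firstLetter j) = ContinuousLinearMap.id ℂ _ := by
  ext1 f
  refine Lp.ext ?_
  rw [sum_apply]
  filter_upwards [Lp.coeFn_finsetSum Finset.univ
      fun j : Fin N => indicatorOp μ (measurableSet_firstLetter j) f,
    ae_all_iff.2 fun j : Fin N => coeFn_indicatorOp (measurableSet_firstLetter j) f] with x h1 h2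
  rw [h1, Finset.sum_apply]
  simp_rw [h2]
  rw [Finset.sum_eq_single (x 0)]
  · simp
  · intro j _ hj
    rw [Set.indicator_of_notMem]
    simpa using hj.symm
  · simp

/-- On the diagonal this is the isometry property; off the diagonal the two weights have disjoint
supports. -/
lemma adjoint_branchOp_comp_branchOp (hμ : IsMarkovMeasure lam T μ) (h : IsMarkovData lam T)
    (hq : IsQuasiStationary T) (i j : Fin N) :
    (branchOp hμ h hq i).adjoint ∘L branchOp hμ h hq j =
      if i = j then ContinuousLinearMap.id ℂ _ else 0 := by
  split_ifs with hij
  · subst hij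
    exact (ContinuousLinearMap.norm_map_iff_adjoint_comp_self _).1
      fun f => IsContractiveWeight.norm_op _ (map_shift_withDensity_weight hμ h hq i) f
  · ext1 f
    refine ext_inner_left ℂ fun g => ?_
    rw [ContinuousLinearMap.comp_apply, ContinuousLinearMap.adjoint_inner_right, L2.inner_def,
      zero_apply, inner_zero_right]
    refine integral_eq_zero_of_ae ?_
    filter_upwards [(isContractiveWeight_weight hμ h hq i).coeFn_op g,
      (isContractiveWeight_weight hμ h hq j).coeFn_op f] with x h1 h2
    rw [branchOp, branchOp, h1, h2]
    by_cases hx : x 0 = i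
    · rw [weight_of_ne (j := j) (by rw [hx]; exact hij)]
      simp
    · rw [weight_of_ne (j := i) hx]
      simp

/-- Compose `S_i*` with the resolution of the identity by the `branchOp ∘ branchCoOp`: by
orthogonality only the term of index `i` survives. -/
lemma adjoint_branchOp (hμ : IsMarkovMeasure lam T μ) (h : IsMarkovData lam T)
    (hq : IsQuasiStationary T) (i : Fin N) :
    (branchOp hμ h hq i).adjoint = branchCoOp hμ h hq i := by
  have hsum : ∑ j, branchOp hμ h hq j ∘L branchCoOp hμ h hq j = ContinuousLinearMap.id ℂ _ := by
    simp_rw [branchOp_comp_branchCoOp]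
    exact sum_indicatorOp_firstLetter
  rw [← (branchOp hμ h hq i).adjoint.comp_id, ← hsum, ContinuousLinearMap.comp_finsetSum,
    Finset.sum_eq_single i]
  · rw [← ContinuousLinearMap.comp_assoc, adjoint_branchOp_comp_branchOp, if_pos rfl,
      ContinuousLinearMap.id_comp]
  · intro j _ hj
    rw [← ContinuousLinearMap.comp_assoc, adjoint_branchOp_comp_branchOp, if_neg hj.symm,
      ContinuousLinearMap.zero_comp]
  · simp

/-- The representation of the Cuntz algebra associated to a quasi-stationary Markov measure. -/
noncomputable def markovRep (hμ : IsMarkovMeasure lam T μ) (h : IsMarkovData lam T)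
    (hq : IsQuasiStationary T) : CuntzRep N (Lp ℂ 2 μ) where
  S := branchOp hμ h hq
  adjoint_comp := adjoint_branchOp_comp_branchOp hμ h hq
  sum_comp_adjoint := by
    simp_rw [adjoint_branchOp, branchOp_comp_branchCoOp]
    exact sum_indicatorOp_firstLetter

lemma isAssociatedRep_markovRep (hμ : IsMarkovMeasure lam T μ) (h : IsMarkovData lam T)
    (hq : IsQuasiStationary T) : IsAssociatedRep lam T μ (markovRep hμ h hq) :=
  fun j f => (isContractiveWeight_weight hμ h hq j).coeFn_op f

/-- An operator that intertwines the generators of two representations of the Cuntz algebra also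
intertwines their adjoints. -/
lemma intertwines_of_comp_eq {H H' : Type*} [NormedAddCommGroup H] [InnerProductSpace ℂ H]
    [CompleteSpace H] [NormedAddCommGroup H'] [InnerProductSpace ℂ H'] [CompleteSpace H']
    {π : CuntzRep N H} {π' : CuntzRep N H'} {W : H →L[ℂ] H'}
    (hW : ∀ i, W ∘L π.S i = π'.S i ∘L W) : Intertwines π π' W := by
  refine fun i => ⟨hW i, ?_⟩
  symm
  have h1 : ∀ j, ((π'.S i).adjoint ∘L W) ∘L (π.S j ∘L (π.S j).adjoint) =
      if i = j then W ∘L (π.S j).adjoint else 0 := fun j => by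
    calc ((π'.S i).adjoint ∘L W) ∘L (π.S j ∘L (π.S j).adjoint)
        = ((π'.S i).adjoint ∘L (W ∘L π.S j)) ∘L (π.S j).adjoint := rfl
      _ = (((π'.S i).adjoint ∘L π'.S j) ∘L W) ∘L (π.S j).adjoint := by rw [hW]; rfl
      _ = _ := by rw [π'.adjoint_comp]; split_ifs <;> simp
  -- Inserting `∑ S_j S_j* = 1` on the right lets `W` pass the `S_j`.
  rw [← ((π'.S i).adjoint ∘L W).comp_id, ← π.sum_comp_adjoint,
    ContinuousLinearMap.comp_finsetSum]
  simp_rw [h1]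
  simp

variable {lam' : Fin N → ℝ} {T' : ℕ → Matrix (Fin N) (Fin N) ℝ} {μ' : Measure (Words N)}

lemma branchOp_comp_indicatorOp_comp_adjoint (hμ : IsMarkovMeasure lam T μ)
    (h : IsMarkovData lam T) (hq : IsQuasiStationary T) (x : Words N) (n : ℕ) :
    branchOp hμ h hq (x 0) ∘L indicatorOp μ (measurableSet_cylinder (shift x) n) ∘L
      (branchOp hμ h hq (x 0)).adjoint = indicatorOp μ (measurableSet_cylinder x (n + 1)) := by
  rw [adjoint_branchOp, ← ContinuousLinearMap.comp_assoc, branchOp_comp_indicatorOp,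
    ContinuousLinearMap.comp_assoc, branchOp_comp_branchCoOp, indicatorOp_comp_indicatorOp]
  congr 1
  exact (cylinder_succ x n).symm

/-- Conjugation by `S_{x 0}` turns the indicator of a cylinder into that of the cylinder with one
more letter in front, and `W` respects the conjugation. -/
lemma Intertwines.indicatorOp_cylinder {hμ : IsMarkovMeasure lam T μ} {h : IsMarkovData lam T}
    {hq : IsQuasiStationary T} {hμ' : IsMarkovMeasure lam' T' μ'} {h' : IsMarkovData lam' T'}
    {hq' : IsQuasiStationary T'} {W : Lp ℂ 2 μ →L[ℂ] Lp ℂ 2 μ'}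
    (hW : Intertwines (markovRep hμ h hq) (markovRep hμ' h' hq') W) (n : ℕ) (x : Words N) :
    W ∘L indicatorOp μ (measurableSet_cylinder x n) =
      indicatorOp μ' (measurableSet_cylinder x n) ∘L W := by
  induction n generalizing x with
  | zero =>
    have hone : ∀ ρ : Measure (Words N), indicatorOp ρ (measurableSet_cylinder x 0) =
        ContinuousLinearMap.id ℂ _ := fun ρ => by
      ext1 f
      refine Lp.ext ?_
      filter_upwards [coeFn_indicatorOp (measurableSet_cylinder x 0) f] with y hy
      rw [hy]
      simp
    rw [hone, hone, ContinuousLinearMap.comp_id, ContinuousLinearMap.id_comp]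
  | succ n ih =>
    obtain ⟨h1, h2⟩ := hW (x 0)
    change W ∘L branchOp hμ h hq (x 0) = branchOp hμ' h' hq' (x 0) ∘L W at h1
    change W ∘L (branchOp hμ h hq (x 0)).adjoint = (branchOp hμ' h' hq' (x 0)).adjoint ∘L W at h2
    rw [← branchOp_comp_indicatorOp_comp_adjoint hμ h hq,
      ← branchOp_comp_indicatorOp_comp_adjoint hμ' h' hq', ← ContinuousLinearMap.comp_assoc, h1,
      ContinuousLinearMap.comp_assoc, ← ContinuousLinearMap.comp_assoc W, ih,
      ContinuousLinearMap.comp_assoc _ W, h2]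
    rfl

/-- Mutually singular measures have disjoint representations. -/
theorem disjointReps_of_mutuallySingular (hμ : IsMarkovMeasure lam T μ) (h : IsMarkovData lam T)
    (hq : IsQuasiStationary T) (hμ' : IsMarkovMeasure lam' T' μ') (h' : IsMarkovData lam' T')
    (hq' : IsQuasiStationary T') (hs : μ ⟂ₘ μ') :
    DisjointReps (markovRep hμ h hq) (markovRep hμ' h' hq') := by
  intro W hW
  ext1 f
  have hfin : ∀ {ρ : Measure (Words N)} (g : Lp ℂ 2 ρ),
      IsFiniteMeasure (ρ.withDensity fun x => ‖g x‖ₑ ^ 2) := fun g => by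
    refine isFiniteMeasure_withDensity ?_
    rw [← enorm_Lp_sq]
    exact ENNReal.pow_ne_top enorm_ne_top
  have := hfin f
  have := hfin (W f)
  have hc : ‖W‖ₑ ^ 2 ≠ ∞ := ENNReal.pow_ne_top enorm_ne_top
  have := Measure.smul_finite (μ.withDensity fun x => ‖f x‖ₑ ^ 2) hc
  have key : (μ'.withDensity fun x => ‖W f x‖ₑ ^ 2) ≤
      ‖W‖ₑ ^ 2 • μ.withDensity fun x => ‖f x‖ₑ ^ 2 := by
    refine measure_le_of_forall_cylinder 0 fun n _ x => ?_
    have hC := measurableSet_cylinder x n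
    rw [Measure.smul_apply, withDensity_apply _ hC, withDensity_apply _ hC,
      ← enorm_indicatorOp_sq hC, ← enorm_indicatorOp_sq hC, smul_eq_mul, ← mul_pow]
    gcongr
    have := DFunLike.congr_fun (hW.indicatorOp_cylinder n x) f
    rw [ContinuousLinearMap.comp_apply, ContinuousLinearMap.comp_apply] at this
    rw [← this]
    exact W.le_opENorm _
  have hac : (μ'.withDensity fun x => ‖W f x‖ₑ ^ 2) ≪ μ :=
    (Measure.absolutelyContinuous_of_le key).trans
      (((withDensity_absolutelyContinuous μ _)).smul_left _)
  -- This measure is absolutely continuous with respect to both `μ` and `μ'`, hence singular to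
  -- itself.
  have h0 := (Measure.MutuallySingular.self_iff _).1
    (hs.mono_ac hac (withDensity_absolutelyContinuous _ _))
  have h1 := withDensity_eq_zero
    ((Lp.stronglyMeasurable (W f)).measurable.enorm.pow_const 2).aemeasurable h0
  refine Lp.ext ?_
  filter_upwards [h1, Lp.coeFn_zero ℂ 2 μ'] with x hx h0x
  rw [zero_apply, h0x]
  simpa using hx

/-- The square root of a density of `μ` relative to `μ'` relates the weights of the two measures. -/
lemma density_mul_weight (hμ : IsMarkovMeasure lam T μ) (h : IsMarkovData lam T)
    (hq : IsQuasiStationary T) (hμ' : IsMarkovMeasure lam' T' μ') (h' : IsMarkovData lam' T')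
    (hq' : IsQuasiStationary T') {g : Words N → ℝ} (hg : Measurable g) (hg0 : ∀ x, 0 ≤ g x)
    (hd : μ'.withDensity (fun x => ENNReal.ofReal (g x ^ 2)) = μ) (j : Fin N) :
    ∀ᵐ x ∂μ', g x * weight lam T j x = weight lam' T' j x * g (shift x) := by
  have := hμ.isProbabilityMeasure h
  have hgm : Measurable fun x => ENNReal.ofReal (g x ^ 2) := (hg.pow_const 2).ennreal_ofReal
  have hwm : Measurable fun x => ENNReal.ofReal (weight lam T j x ^ 2) :=
    ((hq.measurable_weight h j).pow_const 2).ennreal_ofReal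
  have hwm' : Measurable fun x => ENNReal.ofReal (weight lam' T' j x ^ 2) :=
    ((hq'.measurable_weight h' j).pow_const 2).ennreal_ofReal
  have hgs : Measurable fun x => ENNReal.ofReal (g (shift x) ^ 2) := hgm.comp measurable_shift
  -- The image of `μ` under `cons j` is computed twice relative to `μ'`: by passing from `μ'` to `μ`
  -- before applying the branch, or after. Both sides of the claim are nonnegative roots of its
  -- density.
  have e1 : μ.map (cons j) = μ'.withDensity
      ((fun x => ENNReal.ofReal (g x ^ 2)) * fun x => ENNReal.ofReal (weight lam T j x ^ 2)) := by
    rw [withDensity_mul _ hgm hwm, hd, withDensity_weight hμ h hq]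
  have e2 : μ.map (cons j) = μ'.withDensity
      ((fun x => ENNReal.ofReal (weight lam' T' j x ^ 2)) *
        fun x => ENNReal.ofReal (g (shift x) ^ 2)) := by
    rw [withDensity_mul _ hwm' hgs, withDensity_weight hμ' h' hq']
    refine Measure.ext fun B hB => ?_
    rw [Measure.map_apply (measurable_cons j) hB, ← hd, withDensity_apply _ (measurable_cons j hB),
      withDensity_apply _ hB, setLIntegral_map hB hgs (measurable_cons j)]
    rfl
  have hne : ∫⁻ x, ((fun x => ENNReal.ofReal (g x ^ 2)) *
      fun x => ENNReal.ofReal (weight lam T j x ^ 2)) x ∂μ' ≠ ∞ := by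
    rw [← setLIntegral_univ, ← withDensity_apply _ MeasurableSet.univ, ← e1]
    exact measure_ne_top _ _
  have hae := (withDensity_eq_iff (hgm.mul hwm).aemeasurable
    (hwm'.mul hgs).aemeasurable hne).1 (e1.symm.trans e2)
  filter_upwards [hae] with x hx
  rw [Pi.mul_apply, Pi.mul_apply, ← ENNReal.ofReal_mul (sq_nonneg _),
    ← ENNReal.ofReal_mul (sq_nonneg _), ENNReal.ofReal_eq_ofReal_iff (by positivity) (by positivity),
    ← mul_pow, ← mul_pow] at hx
  exact (sq_eq_sq₀ (mul_nonneg (hg0 _) (weight_nonneg _ _))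
    (mul_nonneg (weight_nonneg _ _) (hg0 _))).1 hx

/-- Equivalent measures have unitarily equivalent representations. -/
theorem unitarilyEquivalent_of_absolutelyContinuous
    (hμ : IsMarkovMeasure lam T μ) (h : IsMarkovData lam T)
    (hq : IsQuasiStationary T) (hμ' : IsMarkovMeasure lam' T' μ') (h' : IsMarkovData lam' T')
    (hq' : IsQuasiStationary T') (h1 : μ ≪ μ') (h2 : μ' ≪ μ) :
    UnitarilyEquivalent (markovRep hμ h hq) (markovRep hμ' h' hq') := by
  have := hμ.isProbabilityMeasure h
  have := hμ'.isProbabilityMeasure h'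
  have hmeas : ∀ ρ ρ' : Measure (Words N), Measurable fun x => √(ρ.rnDeriv ρ' x).toReal :=
    fun ρ ρ' => (Measure.measurable_rnDeriv ρ ρ').ennreal_toReal.sqrt
  have hU := isContractiveWeight_density (hmeas μ μ') (withDensity_sqrt_rnDeriv h1)
  have hV := isContractiveWeight_density (hmeas μ' μ) (withDensity_sqrt_rnDeriv h2)
  have hnorm : ∀ f, ‖hU.op f‖ = ‖f‖ := hU.norm_op (by rw [Measure.map_id, withDensity_sqrt_rnDeriv h1])
  -- Surjectivity of the isometry: the root of the reciprocal density gives a right inverse.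
  have hUV : ∀ f, hU.op (hV.op f) = f := by
    intro f
    refine Lp.ext ?_
    filter_upwards [hU.coeFn_op (hV.op f), hU.ae_eq (hV.coeFn_op f),
      sqrt_rnDeriv_mul_sqrt_rnDeriv h2] with x e1 e2 e3
    rw [e1, e2, id, id, ← mul_assoc, ← Complex.ofReal_mul, e3, Complex.ofReal_one, one_mul]
  let U : Lp ℂ 2 μ ≃ₗᵢ[ℂ] Lp ℂ 2 μ' := LinearIsometryEquiv.ofSurjective
    ⟨hU.op.toLinearMap, hnorm⟩ fun f => ⟨hV.op f, hUV f⟩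
  have hUcoe : (U.toContinuousLinearEquiv : Lp ℂ 2 μ →L[ℂ] Lp ℂ 2 μ') = hU.op := rfl
  refine ⟨U, ?_⟩
  rw [hUcoe]
  refine intertwines_of_comp_eq fun j => ?_
  ext1 f
  refine Lp.ext ?_
  have hS := isContractiveWeight_weight hμ h hq j
  have hS' := isContractiveWeight_weight hμ' h' hq' j
  filter_upwards [hU.coeFn_op (hS.op f), hU.ae_eq (hS.coeFn_op f), hS'.coeFn_op (hU.op f),
    hS'.ae_eq (hU.coeFn_op f), density_mul_weight hμ h hq hμ' h' hq' (hmeas μ μ')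
      (fun _ => Real.sqrt_nonneg _) (withDensity_sqrt_rnDeriv h1) j] with x e1 e2 e3 e4 e5
  change (hU.op (hS.op f)) x = (hS'.op (hU.op f)) x
  rw [e1, e2, e3, e4, id, id, ← mul_assoc, ← mul_assoc, ← Complex.ofReal_mul,
    ← Complex.ofReal_mul, e5]

end Cuntz

end QSMarkov

/-! ### Exclusivity of the alternatives, and the theorem. -/

namespace QSMarkov

variable {N : ℕ} {H H' : Type*} [NormedAddCommGroup H] [InnerProductSpace ℂ H] [CompleteSpace H]
  [NormedAddCommGroup H'] [InnerProductSpace ℂ H'] [CompleteSpace H']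

lemma not_disjointReps_of_unitarilyEquivalent [Nontrivial H] {π : CuntzRep N H}
    {π' : CuntzRep N H'} (hU : UnitarilyEquivalent π π') : ¬ DisjointReps π π' := by
  rintro hdis
  obtain ⟨U, hU⟩ := hU
  obtain ⟨v, hv⟩ := exists_ne (0 : H)
  have := DFunLike.congr_fun (hdis _ hU) v
  exact hv (U.map_eq_zero_iff.1 this)

lemma nontrivial_Lp_two {X : Type*} [MeasurableSpace X] (ν : Measure X) [IsProbabilityMeasure ν] :
    Nontrivial (Lp ℂ 2 ν) := by
  refine ⟨⟨Lp.const 2 ν (1 : ℂ), 0, fun h0 => ?_⟩⟩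
  have := Lp.norm_const (p := 2) (μ := ν) (c := (1 : ℂ)) (NeZero.ne _)
  rw [h0] at this
  simp at this

end QSMarkov

theorem theorem4p1 (N : ℕ) (hN : 2 ≤ N)
    (lam lam' : Fin N → ℝ) (T T' : ℕ → Matrix (Fin N) (Fin N) ℝ)
    (h : QSMarkov.IsMarkovData lam T) (h' : QSMarkov.IsMarkovData lam' T')
    (hq : QSMarkov.IsQuasiStationary T) (hq' : QSMarkov.IsQuasiStationary T')
    (μ μ' : Measure (QSMarkov.Words N))
    (hμ : QSMarkov.IsMarkovMeasure lam T μ) (hμ' : QSMarkov.IsMarkovMeasure lam' T' μ') :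
    Xor (μ ≪ μ' ∧ μ' ≪ μ) (μ ⟂ₘ μ') ∧
    ∃ (π : QSMarkov.CuntzRep N (Lp ℂ 2 μ)) (π' : QSMarkov.CuntzRep N (Lp ℂ 2 μ')),
      QSMarkov.IsAssociatedRep lam T μ π ∧ QSMarkov.IsAssociatedRep lam' T' μ' π' ∧
      Xor (QSMarkov.UnitarilyEquivalent π π') (QSMarkov.DisjointReps π π') := by
  have := hμ.isProbabilityMeasure h
  have := QSMarkov.nontrivial_Lp_two μ
  have hdich := QSMarkov.equivalent_or_mutuallySingular hμ h hq hμ' h' hq'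
  refine ⟨?_, QSMarkov.markovRep hμ h hq, QSMarkov.markovRep hμ' h' hq',
    QSMarkov.isAssociatedRep_markovRep hμ h hq, QSMarkov.isAssociatedRep_markovRep hμ' h' hq', ?_⟩
  · rcases hdich with hac | hs
    -- If both alternatives held, `μ` would be singular to itself, hence zero.
    · refine .inl ⟨hac, fun hs => IsProbabilityMeasure.ne_zero μ ?_⟩
      exact (Measure.MutuallySingular.self_iff μ).1
        (hs.mono_ac Measure.AbsolutelyContinuous.rfl hac.1)
    · refine .inr ⟨hs, fun hac => IsProbabilityMeasure.ne_zero μ ?_⟩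
      exact (Measure.MutuallySingular.self_iff μ).1
        (hs.mono_ac Measure.AbsolutelyContinuous.rfl hac.1)
  · rcases hdich with hac | hs
    · have hU := QSMarkov.unitarilyEquivalent_of_absolutelyContinuous hμ h hq hμ' h' hq' hac.1 hac.2
      exact .inl ⟨hU, QSMarkov.not_disjointReps_of_unitarilyEquivalent hU⟩
    · have hD := QSMarkov.disjointReps_of_mutuallySingular hμ h hq hμ' h' hq' hs
      exact .inr ⟨hD, fun hU => QSMarkov.not_disjointReps_of_unitarilyEquivalent hU hD⟩
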